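/- Let $\mathsf{TopStoch}$ be the category whose objects are topological spaces and whose morphisms $k : X \to Y$ are the continuous Markov kernels: for each $x \in X$, $k(\cdot\,|\,x)$ is a Borel probability measure on $Y$ that is $\tau$-smooth (that is, $k(\bigcup\mathcal D\,|\,x) = \sup_{U\in\mathcal D} k(U|x)$ for every upward directed family $\mathcal D$ of open sets), and for each open $U \subseteq Y$ the function $x \mapsto k(U|x)$ is lower semicontinuous on $X$. Composition is $(l\circ k)(A|x)=\int l(A|y)\,k(dy|x)$, identities are Dirac kernels, $X\otimes Y$ is the product topological space, and $(k\otimes l)(\cdot\,|\,x,u)$ is the unique $\tau$-smooth Borel probability measure on the product space with $(k\otimes l)(A\times B\,|\,x,u)=k(A|x)\,l(B|u)$ for Borel $A, B$; the unit is the one-point space $I$, and swap, copy $\Delta_X$ and discard are the Dirac kernels of the evident continuous maps. This is a Markov category. A morphism $f : X \to Y$ is deterministic if $\Delta_Y\circ f=(f\otimes f)\circ\Delta_X$. A group in a Markov category is an object $G$ with deterministic morphisms $G\otimes G\to G$, $I\to G$, $G\to G$ (multiplication, unit, inversion) satisfying the usual group axioms written with copy and discard; an action of $G$ on $X$ is a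 deterministic morphism $\alpha : G\otimes X\to X$ satisfying the usual associativity and unit axioms; the trivial action $\mathrm{triv} : G\otimes X\to X$ discards $G$. An orbit map for $\alpha$ is a deterministic morphism $q : X\to Q$ which is a coequaliser of $\alpha,\mathrm{triv} : G\otimes X\rightrightarrows X$, and such that for every object $Y$ this coequaliser is preserved by $(-)\otimes Y$, that is, $q\otimes \mathrm{id}_Y$ is a coequaliser of $\alpha\otimes \mathrm{id}_Y$ and $\mathrm{triv}\otimes \mathrm{id}_Y$. Theorem. Every action $\alpha : G\otimes X\to X$ of a group $G$ on an object $X$ in $\mathsf{TopStoch}$ admits an orbit map. More precisely, call an open set $U\subseteq X$ invariant if $\alpha(U|g,x)=1$ for all $g\in G$ and $x\in U$; the invariant open sets form a topology on the set $X$. Let $X/G$ be the set $X$ with this topology. Then the Dirac kernel $q : X\to X/G$, $q(A|x)=\delta_x(A)$, is an orbit map for $\alpha$. -/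

import Mathlib

open CategoryTheory MeasureTheory ProbabilityTheory
open scoped ENNReal MonoidalCategory ComonObj

universe v u

/-! ### Groups, actions and orbit maps in a Markov category -/

section MarkovCategory

variable {C : Type u} [Category.{v} C] [MonoidalCategory C] [MarkovCategory C]

/-- A group structure on an object `G` of a Markov category: deterministic multiplication, unit
and inversion, with the group axioms expressed through copying and discarding. -/
class MarkovGroup (G : C) where
  mul : G ⊗ G ⟶ G
  one : 𝟙_ C ⟶ G
  inv : G ⟶ G
  mul_deterministic : Deterministic mul
  one_deterministic : Deterministic one
  inv_deterministic : Deterministic inv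
  mul_assoc : mul ▷ G ≫ mul = (α_ G G G).hom ≫ G ◁ mul ≫ mul
  one_mul : one ▷ G ≫ mul = (λ_ G).hom
  mul_one : G ◁ one ≫ mul = (ρ_ G).hom
  inv_mul : Δ[G] ≫ inv ▷ G ≫ mul = ε[G] ≫ one
  mul_inv : Δ[G] ≫ G ◁ inv ≫ mul = ε[G] ≫ one

/-- `act : G ⊗ X ⟶ X` is an action of the group `G` on `X`. -/
structure IsMarkovAction {G X : C} [MarkovGroup G] (act : G ⊗ X ⟶ X) : Prop where
  deterministic : Deterministic act
  assoc : G ◁ act ≫ act = (α_ G G X).inv ≫ MarkovGroup.mul ▷ X ≫ act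
  unit : MarkovGroup.one ▷ X ≫ act = (λ_ X).hom

/-- The trivial action of `G` on `X`: discard `G`. -/
def trivialAction (G X : C) : G ⊗ X ⟶ X := ε[G] ▷ X ≫ (λ_ X).hom

/-- The fork `f, g : A ⇉ B ⟶ Q` is a coequaliser diagram. -/
def IsCoequaliser {A B Q : C} (f g : A ⟶ B) (q : B ⟶ Q) : Prop :=
  ∃ w : f ≫ q = g ≫ q, Nonempty (Limits.IsColimit (Limits.Cofork.ofπ q w))

/-- `q` is an orbit map for `act`: it is deterministic, it is a coequaliser of `act` and the
trivial action, and this coequaliser is preserved by `(-) ⊗ Y` for every `Y`. -/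
structure IsOrbitMap {G X Q : C} (act : G ⊗ X ⟶ X) (q : X ⟶ Q) : Prop where
  deterministic : Deterministic q
  coequaliser : IsCoequaliser act (trivialAction G X) q
  preserved : ∀ Y : C, IsCoequaliser (act ▷ Y) (trivialAction G X ▷ Y) (q ▷ Y)

end MarkovCategory

/-! ### τ-smooth measures and lower semicontinuous kernels -/

section Borel

/- In this section every topological space carries its Borel σ-algebra; in particular a product
carries the Borel σ-algebra of the product topology. -/
attribute [local instance 2000] borel

/-- A Borel measure is τ-smooth if it is continuous along directed unions of open sets. -/
def IsTauSmooth {X : Type*} [TopologicalSpace X] (μ : Measure X) : Prop :=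
  ∀ D : Set (Set X), (∀ U ∈ D, IsOpen U) → DirectedOn (· ⊆ ·) D →
    μ (⋃₀ D) = ⨆ U ∈ D, μ U

/-- A continuous Markov kernel between topological spaces: a Markov kernel for the Borel
σ-algebras, with τ-smooth values, such that `x ↦ k(U|x)` is lower semicontinuous for every
open `U`. -/
structure ContKernel (X Y : Type*) [TopologicalSpace X] [TopologicalSpace Y] where
  kernel : Kernel X Y
  isMarkov : IsMarkovKernel kernel
  tauSmooth : ∀ x, IsTauSmooth (kernel x)
  lsc : ∀ U : Set Y, IsOpen U → LowerSemicontinuous fun x => kernel x U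

attribute [instance] ContKernel.isMarkov

variable {X Y Z W : Type*} [TopologicalSpace X] [TopologicalSpace Y] [TopologicalSpace Z]
  [TopologicalSpace W]

lemma borelMeasurable {f : X → Y} (hf : Continuous f) : Measurable f :=
  hf.borel_measurable

lemma IsOpen.borelMeasurableSet {U : Set X} (h : IsOpen U) : MeasurableSet U :=
  MeasurableSpace.measurableSet_generateFrom h

lemma measure_eq_of_open {μ ν : Measure X} [IsProbabilityMeasure μ] [IsProbabilityMeasure ν]
    (h : ∀ U, IsOpen U → μ U = ν U) : μ = ν :=
  ext_of_generate_finite {U | IsOpen U} rfl isPiSystem_isOpen h (by simp)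

lemma IsTauSmooth.map {μ : Measure X} (hμ : IsTauSmooth μ) {f : X → Y} (hf : Continuous f) :
    IsTauSmooth (μ.map f) := by
  intro D hD hdir
  have hm := borelMeasurable hf
  rw [Measure.map_apply hm (isOpen_sUnion hD).borelMeasurableSet]
  have h1 : f ⁻¹' (⋃₀ D) = ⋃₀ ((fun U => f ⁻¹' U) '' D) := by
    ext x; simp
  rw [h1, hμ]
  · rw [iSup_image]
    refine iSup_congr fun U => iSup_congr fun hU => ?_
    rw [Measure.map_apply hm (hD U hU).borelMeasurableSet]
  · rintro _ ⟨U, hU, rfl⟩; exact (hD U hU).preimage hf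
  · rintro _ ⟨U, hU, rfl⟩ _ ⟨V, hV, rfl⟩
    obtain ⟨T, hT, h1, h2⟩ := hdir U hU V hV
    exact ⟨_, ⟨T, hT, rfl⟩, Set.preimage_mono h1, Set.preimage_mono h2⟩

lemma isTauSmooth_dirac (x : X) : IsTauSmooth (Measure.dirac x) := by
  intro D hD hdir
  rw [Measure.dirac_apply' _ (isOpen_sUnion hD).borelMeasurableSet]
  apply le_antisymm
  · by_cases hx : x ∈ ⋃₀ D
    · obtain ⟨U, hU, hxU⟩ := hx
      refine le_trans ?_ (le_iSup₂ (f := fun U (_ : U ∈ D) => Measure.dirac x U) U hU)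
      rw [Measure.dirac_apply' _ (hD U hU).borelMeasurableSet]
      simp [hxU, Set.indicator]
      split_ifs <;> simp
    · simp [hx]
  · refine iSup₂_le fun U hU => ?_
    rw [Measure.dirac_apply' _ (hD U hU).borelMeasurableSet]
    exact Set.indicator_le_indicator_of_subset (Set.subset_sUnion_of_mem hU) (by simp) x

/-- Lower semicontinuity on open sets already gives measurability. -/
def ContKernel.ofFun (k : X → Measure Y) (hp : ∀ x, IsProbabilityMeasure (k x))
    (hs : ∀ x, IsTauSmooth (k x))
    (hl : ∀ U : Set Y, IsOpen U → LowerSemicontinuous fun x => k x U) : ContKernel X Y where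
  kernel := ⟨k, Measurable.measure_of_isPiSystem_of_isProbabilityMeasure
    (S := {U | IsOpen U}) rfl isPiSystem_isOpen fun U hU => by
      have : BorelSpace X := ⟨rfl⟩
      exact (hl U hU).measurable⟩
  isMarkov := ⟨hp⟩
  tauSmooth := hs
  lsc := hl

@[simp] lemma ContKernel.ofFun_apply (k : X → Measure Y) (hp hs hl) (x : X) :
    (ContKernel.ofFun k hp hs hl).kernel x = k x := rfl

lemma ContKernel.ext_open {k l : ContKernel X Y}
    (h : ∀ x U, IsOpen U → k.kernel x U = l.kernel x U) : k = l := by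
  cases k with | mk k hk _ _ => cases l with | mk l hl _ _ =>
  have : k = l := by
    ext1 x
    exact measure_eq_of_open (h x)
  subst this; rfl

lemma ContKernel.ext_apply {k l : ContKernel X Y}
    (h : ∀ x, k.kernel x = l.kernel x) : k = l :=
  ContKernel.ext_open fun x U _ => by rw [h x]

/-- The level-set approximation of the integral of a `[0,1]`-valued function. -/
lemma lintegral_eq_iSup_levels (μ : Measure X) [IsProbabilityMeasure μ] (f : X → ℝ≥0∞)
    (hf : LowerSemicontinuous f) (h1 : ∀ x, f x ≤ 1) :
    ∫⁻ x, f x ∂μ = ⨆ n : ℕ, ∑ k ∈ Finset.range (n + 1),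
      ((n + 1 : ℕ) : ℝ≥0∞)⁻¹ * μ {x | ((k + 1 : ℕ) : ℝ≥0∞) * ((n + 1 : ℕ) : ℝ≥0∞)⁻¹ < f x} := by
  have hopen : ∀ t : ℝ≥0∞, MeasurableSet {x | t < f x} := fun t =>
    (hf.isOpen_preimage t).borelMeasurableSet
  have hint : ∀ n : ℕ, ∑ k ∈ Finset.range (n + 1),
      ((n + 1 : ℕ) : ℝ≥0∞)⁻¹ * μ {x | ((k + 1 : ℕ) : ℝ≥0∞) * ((n + 1 : ℕ) : ℝ≥0∞)⁻¹ < f x}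
      = ∫⁻ x, ∑ k ∈ Finset.range (n + 1), ((n + 1 : ℕ) : ℝ≥0∞)⁻¹ *
        Set.indicator {x | ((k + 1 : ℕ) : ℝ≥0∞) * ((n + 1 : ℕ) : ℝ≥0∞)⁻¹ < f x} 1 x ∂μ := by
    intro n
    rw [lintegral_finsetSum _ fun k _ => (measurable_one.indicator (hopen _)).const_mul _]
    refine Finset.sum_congr rfl fun k _ => ?_
    rw [lintegral_const_mul _ (measurable_one.indicator (hopen _)),
      lintegral_indicator_one (hopen _)]
  have hpt : ∀ (n : ℕ) (x : X), ∑ k ∈ Finset.range (n + 1), ((n + 1 : ℕ) : ℝ≥0∞)⁻¹ *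
        Set.indicator {x | ((k + 1 : ℕ) : ℝ≥0∞) * ((n + 1 : ℕ) : ℝ≥0∞)⁻¹ < f x} 1 x ≤ f x ∧
      f x ≤ ∑ k ∈ Finset.range (n + 1), ((n + 1 : ℕ) : ℝ≥0∞)⁻¹ *
        Set.indicator {x | ((k + 1 : ℕ) : ℝ≥0∞) * ((n + 1 : ℕ) : ℝ≥0∞)⁻¹ < f x} 1 x
        + ((n + 1 : ℕ) : ℝ≥0∞)⁻¹ := by
    intro n x
    have hfx : f x ≠ ∞ := ne_top_of_le_ne_top ENNReal.one_ne_top (h1 x)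
    obtain ⟨r, hr⟩ : ∃ r : NNReal, f x = r := ⟨(f x).toNNReal, (ENNReal.coe_toNNReal hfx).symm⟩
    have hr1 : r ≤ 1 := by have := h1 x; rw [hr] at this; exact_mod_cast this
    have hN : (0 : NNReal) < ((n + 1 : ℕ) : NNReal) := by positivity
    have hfil : (Finset.range (n + 1)).filter
        (fun k => ((k + 1 : ℕ) : ℝ≥0∞) * ((n + 1 : ℕ) : ℝ≥0∞)⁻¹ < f x)
        = Finset.range (⌈r * ((n + 1 : ℕ) : NNReal)⌉₊ - 1) := by
      have hc : ⌈r * ((n + 1 : ℕ) : NNReal)⌉₊ ≤ n + 1 := by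
        rw [Nat.ceil_le]; exact mul_le_of_le_one_left hN.le hr1
      ext k
      have : ((k + 1 : ℕ) : ℝ≥0∞) * ((n + 1 : ℕ) : ℝ≥0∞)⁻¹ < f x ↔
          k + 1 < ⌈r * ((n + 1 : ℕ) : NNReal)⌉₊ := by
        rw [Nat.lt_ceil, hr, ← div_eq_mul_inv, ENNReal.div_lt_iff (by simp) (by simp)]
        rw [← ENNReal.coe_natCast, ← ENNReal.coe_natCast, ← ENNReal.coe_mul, ENNReal.coe_lt_coe]
      rw [Finset.mem_filter, this, Finset.mem_range, Finset.mem_range]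
      omega
    have hsum : ∑ k ∈ Finset.range (n + 1), ((n + 1 : ℕ) : ℝ≥0∞)⁻¹ *
        Set.indicator {x | ((k + 1 : ℕ) : ℝ≥0∞) * ((n + 1 : ℕ) : ℝ≥0∞)⁻¹ < f x} 1 x
        = ((⌈r * ((n + 1 : ℕ) : NNReal)⌉₊ - 1 : ℕ) : ℝ≥0∞) * ((n + 1 : ℕ) : ℝ≥0∞)⁻¹ := by
      rw [← Finset.mul_sum, mul_comm]
      congr 1
      have : ∀ k, Set.indicator {x | ((k + 1 : ℕ) : ℝ≥0∞) * ((n + 1 : ℕ) : ℝ≥0∞)⁻¹ < f x}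
          (1 : X → ℝ≥0∞) x
          = if ((k + 1 : ℕ) : ℝ≥0∞) * ((n + 1 : ℕ) : ℝ≥0∞)⁻¹ < f x then 1 else 0 := by
        intro k; simp [Set.indicator]
      simp_rw [this]
      rw [← Finset.sum_filter, hfil]
      simp
    rw [hsum]
    constructor
    · rw [hr, ← div_eq_mul_inv]
      refine ENNReal.div_le_of_le_mul ?_
      rw [← ENNReal.coe_natCast, ← ENNReal.coe_natCast, ← ENNReal.coe_mul, ENNReal.coe_le_coe]
      rcases Nat.eq_zero_or_pos (⌈r * ((n + 1 : ℕ) : NNReal)⌉₊ - 1) with h | h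
      · rw [h]; simp
      · exact (Nat.lt_ceil.mp (by omega)).le
    · rw [← add_one_mul, hr, ← div_eq_mul_inv, ENNReal.le_div_iff_mul_le (by simp) (by simp)]
      have h2 := Nat.le_ceil (r * ((n + 1 : ℕ) : NNReal))
      have h3 : ⌈r * ((n + 1 : ℕ) : NNReal)⌉₊ ≤ (⌈r * ((n + 1 : ℕ) : NNReal)⌉₊ - 1) + 1 := by omega
      have h4 : (⌈r * ((n + 1 : ℕ) : NNReal)⌉₊ : NNReal) ≤
        ((⌈r * ((n + 1 : ℕ) : NNReal)⌉₊ - 1 : ℕ) : NNReal) + 1 := by exact_mod_cast h3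
      have := h2.trans h4
      exact_mod_cast this
  apply le_antisymm
  · refine ENNReal.le_of_forall_pos_le_add fun δ hδ _ => ?_
    obtain ⟨n, hn⟩ := ENNReal.exists_inv_nat_lt (ENNReal.coe_pos.mpr hδ).ne'
    have hn' : ((n + 1 : ℕ) : ℝ≥0∞)⁻¹ ≤ δ :=
      le_trans (ENNReal.inv_le_inv.mpr (by exact_mod_cast Nat.le_succ n)) hn.le
    calc ∫⁻ x, f x ∂μ ≤ _ := lintegral_mono fun x => (hpt n x).2
      _ = _ := lintegral_add_right _ measurable_const
      _ ≤ _ := by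
        rw [← hint n]
        refine add_le_add (le_iSup (fun n : ℕ => ∑ k ∈ Finset.range (n + 1),
          ((n + 1 : ℕ) : ℝ≥0∞)⁻¹ *
          μ {x | ((k + 1 : ℕ) : ℝ≥0∞) * ((n + 1 : ℕ) : ℝ≥0∞)⁻¹ < f x}) n) ?_
        simpa using hn'
  · refine iSup_le fun n => ?_
    rw [hint n]
    exact lintegral_mono fun x => (hpt n x).1

lemma lowerSemicontinuous_lintegral (k : ContKernel X Y) (f : Y → ℝ≥0∞)
    (hf : LowerSemicontinuous f) (h1 : ∀ x, f x ≤ 1) :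
    LowerSemicontinuous fun x => ∫⁻ y, f y ∂(k.kernel x) := by
  simp_rw [fun x => lintegral_eq_iSup_levels (k.kernel x) f hf h1]
  refine lowerSemicontinuous_iSup fun n => lowerSemicontinuous_sum fun j _ => ?_
  have := k.lsc {y | ((j + 1 : ℕ) : ℝ≥0∞) * ((n + 1 : ℕ) : ℝ≥0∞)⁻¹ < f y}
    (hf.isOpen_preimage _)
  exact (ENNReal.continuous_const_mul (by simp)).comp_lowerSemicontinuous this
    fun a b hab => mul_le_mul_right hab _

lemma IsTauSmooth.lintegral_iSup {μ : Measure X} [IsProbabilityMeasure μ] (hμ : IsTauSmooth μ)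
    {ι : Type*} (f : ι → X → ℝ≥0∞)
    (hf : ∀ i, LowerSemicontinuous (f i)) (h1 : ∀ i x, f i x ≤ 1) (hd : Directed (· ≤ ·) f) :
    ∫⁻ x, ⨆ i, f i x ∂μ = ⨆ i, ∫⁻ x, f i x ∂μ := by
  rw [lintegral_eq_iSup_levels μ _ (lowerSemicontinuous_iSup hf) (fun x => iSup_le fun i => h1 i x)]
  simp_rw [fun i => lintegral_eq_iSup_levels μ (f i) (hf i) (h1 i)]
  rw [iSup_comm]
  refine iSup_congr fun n => ?_
  have key : ∀ t : ℝ≥0∞, μ {x | t < ⨆ i, f i x} = ⨆ i, μ {x | t < f i x} := by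
    intro t
    have : {x | t < ⨆ i, f i x} = ⋃₀ (Set.range fun i => {x | t < f i x}) := by
      ext x; simp [lt_iSup_iff]
    rw [this, hμ, iSup_range]
    · rintro _ ⟨i, rfl⟩; exact (hf i).isOpen_preimage t
    · rintro _ ⟨i, rfl⟩ _ ⟨j, rfl⟩
      obtain ⟨l, h1, h2⟩ := hd i j
      exact ⟨_, ⟨l, rfl⟩, fun x hx => lt_of_lt_of_le hx (h1 x), fun x hx => lt_of_lt_of_le hx (h2 x)⟩
  simp_rw [key, ENNReal.mul_iSup]
  refine ENNReal.finsetSum_iSup fun i j => ?_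
  obtain ⟨l, h1, h2⟩ := hd i j
  refine ⟨l, fun a => ⟨?_, ?_⟩⟩
  · gcongr with x; exact h1 x
  · gcongr with x; exact h2 x

/-- The Dirac kernel `x ↦ δ_{f x}` of a continuous map. -/
noncomputable def ContKernel.dirac (f : X → Y) (hf : Continuous f) : ContKernel X Y :=
  .ofFun (fun x => Measure.dirac (f x)) (fun _ => inferInstance) (fun _ => isTauSmooth_dirac _)
    fun U hU => by
      simp_rw [fun x => Measure.dirac_apply' (f x) hU.borelMeasurableSet]
      exact (hU.lowerSemicontinuous_indicator zero_le_one).comp hf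

/-- Composition of kernels: `(l ∘ k)(A|x) = ∫ l(A|y) k(dy|x)`. -/
noncomputable def ContKernel.comp (l : ContKernel Y Z) (k : ContKernel X Y) : ContKernel X Z where
  kernel := l.kernel ∘ₖ k.kernel
  isMarkov := inferInstance
  tauSmooth x := by
    intro D hD hdir
    rw [Kernel.comp_apply' _ _ _ (isOpen_sUnion hD).borelMeasurableSet]
    simp_rw [fun y => l.tauSmooth y D hD hdir, iSup_subtype']
    rw [(k.tauSmooth x).lintegral_iSup]
    · refine iSup_congr fun U => ?_
      rw [Kernel.comp_apply' _ _ _ (hD U U.2).borelMeasurableSet]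
    · exact fun U => l.lsc U (hD U U.2)
    · exact fun U y => prob_le_one
    · rintro ⟨U, hU⟩ ⟨V, hV⟩
      obtain ⟨T, hT, h1, h2⟩ := hdir U hU V hV
      exact ⟨⟨T, hT⟩, fun y => measure_mono h1, fun y => measure_mono h2⟩
  lsc U hU := by
    simp_rw [fun x => Kernel.comp_apply' l.kernel k.kernel x hU.borelMeasurableSet]
    exact lowerSemicontinuous_lintegral k _ (l.lsc U hU) fun _ => prob_le_one

/-- The kernel `id ⊗ k`: given `(w, x)`, keep `w` and sample from `k` at `x`. -/
noncomputable def ContKernel.whiskerLeft (W : Type*) [TopologicalSpace W] (k : ContKernel X Y) :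
    ContKernel (W × X) (W × Y) :=
  .ofFun (fun p => (k.kernel p.2).map fun y => (p.1, y))
    (fun p => Measure.isProbabilityMeasure_map
      (borelMeasurable (Continuous.prodMk_right p.1)).aemeasurable)
    (fun p => (k.tauSmooth p.2).map (Continuous.prodMk_right p.1))
    (by
      intro U hU
      have hm : ∀ w : W, Measurable fun y : Y => (w, y) := fun w =>
        borelMeasurable (Continuous.prodMk_right w)
      simp_rw [fun p : W × X => Measure.map_apply (μ := k.kernel p.2) (hm p.1)
        hU.borelMeasurableSet]
      rintro ⟨w, x⟩ t ht
      let D : Set (Set Y) := {B | IsOpen B ∧ ∃ A : Set W, IsOpen A ∧ w ∈ A ∧ A ×ˢ B ⊆ U}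
      have hD : ∀ B ∈ D, IsOpen B := fun B hB => hB.1
      have hdir : DirectedOn (· ⊆ ·) D := by
        rintro B ⟨hB, A, hA, hw, hs⟩ B' ⟨hB', A', hA', hw', hs'⟩
        refine ⟨B ∪ B', ⟨hB.union hB', A ∩ A', hA.inter hA', ⟨hw, hw'⟩, ?_⟩,
          Set.subset_union_left, Set.subset_union_right⟩
        rintro ⟨a, b⟩ ⟨⟨ha, ha'⟩, hb | hb⟩
        · exact hs ⟨ha, hb⟩
        · exact hs' ⟨ha', hb⟩
      have hun : (fun y : Y => (w, y)) ⁻¹' U = ⋃₀ D := by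
        ext y
        constructor
        · intro hy
          obtain ⟨A, B, hA, hB, hw, hyB, hs⟩ := isOpen_prod_iff.mp hU w y hy
          exact ⟨B, ⟨hB, A, hA, hw, hs⟩, hyB⟩
        · rintro ⟨B, ⟨_, A, _, hw, hs⟩, hy⟩
          exact hs ⟨hw, hy⟩
      have ht' : t < k.kernel x (⋃₀ D) := by rw [← hun]; exact ht
      rw [k.tauSmooth x D hD hdir, lt_iSup_iff] at ht'
      obtain ⟨B, hB⟩ := ht'
      rw [lt_iSup_iff] at hB
      obtain ⟨⟨hBo, A, hA, hw, hs⟩, hB⟩ := hB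
      have e1 : ∀ᶠ p : W × X in nhds (w, x), p.1 ∈ A :=
        continuous_fst.continuousAt.eventually (hA.mem_nhds hw)
      have e2 : ∀ᶠ p : W × X in nhds (w, x), t < k.kernel p.2 B :=
        (continuous_snd.continuousAt (x := (w, x))).eventually
          (p := fun a => t < k.kernel a B) (k.lsc B hBo x t hB)
      filter_upwards [e1, e2] with p h1 h2
      exact h2.trans_le (measure_mono fun y hy => hs ⟨h1, hy⟩))

/-- The kernel `k ⊗ id`: given `(x, w)`, sample from `k` at `x` and keep `w`. -/
noncomputable def ContKernel.whiskerRight (k : ContKernel X Y) (W : Type*) [TopologicalSpace W] :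
    ContKernel (X × W) (Y × W) :=
  .ofFun (fun p => (k.kernel p.1).map fun y => (y, p.2))
    (fun p => Measure.isProbabilityMeasure_map
      (borelMeasurable (Continuous.prodMk_left p.2)).aemeasurable)
    (fun p => (k.tauSmooth p.1).map (Continuous.prodMk_left p.2))
    (by
      intro U hU
      have hU' : IsOpen (Prod.swap ⁻¹' U : Set (W × Y)) := hU.preimage continuous_swap
      have h := ((k.whiskerLeft W).lsc _ hU').comp (continuous_swap (X := X) (Y := W))
      convert h using 2 with p
      change _ = ((k.kernel p.1).map fun y => (p.2, y)) _
      rw [Measure.map_apply (borelMeasurable (Continuous.prodMk_left p.2)) hU.borelMeasurableSet,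
        Measure.map_apply (borelMeasurable (Continuous.prodMk_right p.2)) hU'.borelMeasurableSet]
      rfl)

namespace ContKernel

lemma comp_apply_open (l : ContKernel Y Z) (k : ContKernel X Y) (x : X) {A : Set Z}
    (hA : MeasurableSet A) : (l.comp k).kernel x A = ∫⁻ y, l.kernel y A ∂(k.kernel x) :=
  Kernel.comp_apply' _ _ _ hA

lemma dirac_apply (f : X → Y) (hf : Continuous f) (x : X) :
    (dirac f hf).kernel x = Measure.dirac (f x) := rfl

lemma whiskerLeft_apply (k : ContKernel X Y) (p : W × X) :
    (k.whiskerLeft W).kernel p = (k.kernel p.2).map fun y => (p.1, y) := rfl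

lemma whiskerRight_apply (k : ContKernel X Y) (p : X × W) :
    (k.whiskerRight W).kernel p = (k.kernel p.1).map fun y => (y, p.2) := rfl

lemma kernel_measurable_coe (k : ContKernel X Y) {A : Set Y} (hA : MeasurableSet A) :
    Measurable fun x => k.kernel x A := k.kernel.measurable_coe hA

lemma comp_dirac (k : ContKernel Y Z) (f : X → Y) (hf : Continuous f) (x : X) :
    (k.comp (dirac f hf)).kernel x = k.kernel (f x) := by
  ext A hA
  rw [comp_apply_open _ _ _ hA, dirac_apply, lintegral_dirac' _ (k.kernel_measurable_coe hA)]

lemma dirac_comp (k : ContKernel X Y) (f : Y → Z) (hf : Continuous f) (x : X) :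
    ((dirac f hf).comp k).kernel x = (k.kernel x).map f := by
  ext A hA
  have hm := borelMeasurable hf
  rw [comp_apply_open _ _ _ hA, Measure.map_apply hm hA, ← lintegral_indicator_one (hm hA)]
  refine lintegral_congr fun y => ?_
  rw [dirac_apply, Measure.dirac_apply' _ hA]
  rfl

lemma dirac_comp_dirac (f : X → Y) (hf : Continuous f) (g : Y → Z) (hg : Continuous g) :
    (dirac g hg).comp (dirac f hf) = dirac (g ∘ f) (hg.comp hf) :=
  ext_apply fun x => by rw [comp_dirac]; rfl

lemma whiskerLeft_dirac (f : X → Y) (hf : Continuous f) :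
    (dirac f hf).whiskerLeft W = dirac (Prod.map id f) (continuous_id.prodMap hf) :=
  ext_apply fun p => by
    rw [whiskerLeft_apply, dirac_apply, dirac_apply,
      Measure.map_dirac' (borelMeasurable (Continuous.prodMk_right p.1))]
    rfl

lemma whiskerRight_dirac (f : X → Y) (hf : Continuous f) :
    (dirac f hf).whiskerRight W = dirac (Prod.map f id) (hf.prodMap continuous_id) :=
  ext_apply fun p => by
    rw [whiskerRight_apply, dirac_apply, dirac_apply,
      Measure.map_dirac' (borelMeasurable (Continuous.prodMk_left p.2))]
    rfl

lemma comp_assoc' {V : Type*} [TopologicalSpace V] (m : ContKernel Z V) (l : ContKernel Y Z)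
    (k : ContKernel X Y) : (m.comp l).comp k = m.comp (l.comp k) :=
  ext_apply fun x => by
    change ((m.kernel ∘ₖ l.kernel) ∘ₖ k.kernel) x = (m.kernel ∘ₖ (l.kernel ∘ₖ k.kernel)) x
    rw [Kernel.comp_assoc]

lemma whiskerLeft_comp (l : ContKernel Y Z) (k : ContKernel X Y) :
    (l.comp k).whiskerLeft W = (l.whiskerLeft W).comp (k.whiskerLeft W) :=
  ext_apply fun p => by
    ext A hA
    have h1 := borelMeasurable (Continuous.prodMk_right (Y := Z) p.1)
    have h2 := borelMeasurable (Continuous.prodMk_right (Y := Y) p.1)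
    rw [comp_apply_open _ _ _ hA, whiskerLeft_apply, whiskerLeft_apply,
      lintegral_map (kernel_measurable_coe _ hA) h2, Measure.map_apply h1 hA,
      comp_apply_open _ _ _ (h1 hA)]
    refine lintegral_congr fun y => ?_
    rw [whiskerLeft_apply, Measure.map_apply h1 hA]

lemma whiskerRight_comp (l : ContKernel Y Z) (k : ContKernel X Y) :
    (l.comp k).whiskerRight W = (l.whiskerRight W).comp (k.whiskerRight W) :=
  ext_apply fun p => by
    ext A hA
    have h1 := borelMeasurable (Continuous.prodMk_left (X := Z) p.2)
    have h2 := borelMeasurable (Continuous.prodMk_left (X := Y) p.2)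
    rw [comp_apply_open _ _ _ hA, whiskerRight_apply, whiskerRight_apply,
      lintegral_map (kernel_measurable_coe _ hA) h2, Measure.map_apply h1 hA,
      comp_apply_open _ _ _ (h1 hA)]
    refine lintegral_congr fun y => ?_
    rw [whiskerRight_apply, Measure.map_apply h1 hA]

/-- τ-smooth probability measures on a product are determined on open rectangles. -/
lemma _root_.IsTauSmooth.ext_prod {μ ν : Measure (X × Y)} [IsProbabilityMeasure μ]
    [IsProbabilityMeasure ν] (hμ : IsTauSmooth μ) (hν : IsTauSmooth ν)
    (h : ∀ (A : Set X) (B : Set Y), IsOpen A → IsOpen B → μ (A ×ˢ B) = ν (A ×ˢ B)) : μ = ν := by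
  let R : Set (Set (X × Y)) := {S | ∃ A B, IsOpen A ∧ IsOpen B ∧ A ×ˢ B = S}
  have hpi : IsPiSystem R := by
    rintro _ ⟨A, B, hA, hB, rfl⟩ _ ⟨A', B', hA', hB', rfl⟩ _
    exact ⟨A ∩ A', B ∩ B', hA.inter hA', hB.inter hB', Set.prod_inter_prod.symm⟩
  have hle : MeasurableSpace.generateFrom R ≤ borel (X × Y) := by
    refine MeasurableSpace.generateFrom_le ?_
    rintro _ ⟨A, B, hA, hB, rfl⟩
    exact (hA.prod hB).borelMeasurableSet
  have heq : ∀ S, MeasurableSet[MeasurableSpace.generateFrom R] S → μ S = ν S := fun S hS =>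
    ext_on_measurableSpace_of_generate_finite (borel (X × Y)) R
      (by rintro _ ⟨A, B, hA, hB, rfl⟩; exact h A B hA hB) hle rfl hpi (by simp) hS
  refine measure_eq_of_open fun U hU => ?_
  let D : Set (Set (X × Y)) :=
    {S | IsOpen S ∧ S ⊆ U ∧ MeasurableSet[MeasurableSpace.generateFrom R] S}
  have hD : ∀ S ∈ D, IsOpen S := fun S hS => hS.1
  have hdir : DirectedOn (· ⊆ ·) D := fun S hS T hT =>
    ⟨S ∪ T, ⟨hS.1.union hT.1, Set.union_subset hS.2.1 hT.2.1, hS.2.2.union hT.2.2⟩,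
      Set.subset_union_left, Set.subset_union_right⟩
  have hun : U = ⋃₀ D := by
    ext ⟨x, y⟩
    constructor
    · intro hy
      obtain ⟨A, B, hA, hB, hx, hyB, hs⟩ := isOpen_prod_iff.mp hU x y hy
      exact ⟨A ×ˢ B, ⟨hA.prod hB, hs,
        MeasurableSpace.measurableSet_generateFrom ⟨A, B, hA, hB, rfl⟩⟩, hx, hyB⟩
    · rintro ⟨S, hS, hy⟩
      exact hS.2.1 hy
  rw [hun, hμ D hD hdir, hν D hD hdir]
  exact iSup_congr fun S => iSup_congr fun hS => heq S hS.2.2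

/-- Sampling independently from `k` and `l` gives the product measure on rectangles. -/
lemma whisker_rect {V : Type*} [TopologicalSpace V] (k : ContKernel X Y) (l : ContKernel V Z)
    (p : X × V) {A : Set Y} {B : Set Z} (hA : MeasurableSet A)
    (hAB : MeasurableSet (A ×ˢ B)) :
    ((l.whiskerLeft Y).comp (k.whiskerRight V)).kernel p (A ×ˢ B)
      = k.kernel p.1 A * l.kernel p.2 B := by
  have h1 := borelMeasurable (Continuous.prodMk_left (X := Y) p.2)
  rw [comp_apply_open _ _ _ hAB, whiskerRight_apply,
    lintegral_map (kernel_measurable_coe _ hAB) h1]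
  have : ∀ y, (l.whiskerLeft Y).kernel (y, p.2) (A ×ˢ B)
      = A.indicator (fun _ => l.kernel p.2 B) y := by
    intro y
    rw [whiskerLeft_apply, Measure.map_apply (borelMeasurable (Continuous.prodMk_right y)) hAB]
    by_cases hy : y ∈ A <;> simp [hy]
  simp_rw [this]
  rw [lintegral_indicator_const hA, mul_comm]

lemma whisker_rect' {V : Type*} [TopologicalSpace V] (k : ContKernel X Y) (l : ContKernel V Z)
    (p : X × V) {A : Set Y} {B : Set Z} (hB : MeasurableSet B)
    (hAB : MeasurableSet (A ×ˢ B)) :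
    ((k.whiskerRight Z).comp (l.whiskerLeft X)).kernel p (A ×ˢ B)
      = k.kernel p.1 A * l.kernel p.2 B := by
  have h1 := borelMeasurable (Continuous.prodMk_right (Y := Z) p.1)
  rw [comp_apply_open _ _ _ hAB, whiskerLeft_apply,
    lintegral_map (kernel_measurable_coe _ hAB) h1]
  have : ∀ z, (k.whiskerRight Z).kernel (p.1, z) (A ×ˢ B)
      = B.indicator (fun _ => k.kernel p.1 A) z := by
    intro z
    rw [whiskerRight_apply, Measure.map_apply (borelMeasurable (Continuous.prodMk_left z)) hAB]
    by_cases hz : z ∈ B <;> simp [hz]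
  simp_rw [this]
  rw [lintegral_indicator_const hB]

lemma whisker_exchange {V : Type*} [TopologicalSpace V] (k : ContKernel X Y)
    (l : ContKernel V Z) :
    (k.whiskerRight Z).comp (l.whiskerLeft X) = (l.whiskerLeft Y).comp (k.whiskerRight V) :=
  ext_apply fun p => IsTauSmooth.ext_prod (tauSmooth _ p) (tauSmooth _ p) fun A B hA hB => by
    rw [whisker_rect k l p hA.borelMeasurableSet
      (hA.prod hB).borelMeasurableSet,
      whisker_rect' k l p hB.borelMeasurableSet (hA.prod hB).borelMeasurableSet]

end ContKernel

end Borel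

/-! ### The Markov category `TopStoch` -/

/-- Objects of `TopStoch`: topological spaces. -/
structure TopStoch : Type (u + 1) where
  of ::
  carrier : Type u
  [str : TopologicalSpace carrier]

attribute [instance] TopStoch.str

namespace TopStoch

noncomputable section

open ContKernel

instance : LargeCategory TopStoch.{u} where
  Hom X Y := ContKernel X.carrier Y.carrier
  id X := ContKernel.dirac id continuous_id
  comp k l := ContKernel.comp l k
  id_comp k := ext_apply fun x => comp_dirac _ _ _ x
  comp_id k := ext_apply fun x => by rw [dirac_comp]; exact Measure.map_id
  assoc k l m := (comp_assoc' m l k).symm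

/-- The morphism `x ↦ δ_{f x}` given by a continuous function. -/
def diracHom {X Y : TopStoch.{u}} (f : X.carrier → Y.carrier) (hf : Continuous f) : X ⟶ Y :=
  ContKernel.dirac f hf

/-- The isomorphism given by a homeomorphism. -/
def diracIso {X Y : TopStoch.{u}} (f : X.carrier ≃ₜ Y.carrier) : X ≅ Y where
  hom := diracHom f f.continuous
  inv := diracHom f.symm f.symm.continuous
  hom_inv_id := (dirac_comp_dirac _ _ _ _).trans (by congr 1; ext x; simp)
  inv_hom_id := (dirac_comp_dirac _ _ _ _).trans (by congr 1; ext x; simp)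

instance : MonoidalCategoryStruct TopStoch.{u} where
  tensorObj X Y := of (X.carrier × Y.carrier)
  whiskerLeft X _ _ k := ContKernel.whiskerLeft X.carrier k
  whiskerRight k Y := ContKernel.whiskerRight k Y.carrier
  tensorUnit := of PUnit
  associator X Y Z := diracIso (Homeomorph.prodAssoc X.carrier Y.carrier Z.carrier)
  leftUnitor X := diracIso (Homeomorph.punitProd X.carrier)
  rightUnitor X := diracIso (Homeomorph.prodPUnit X.carrier)

section aux

variable {X Y Z W X' Y' Z' : TopStoch.{u}}

lemma hom_ext_apply {k l : X ⟶ Y} (h : ∀ x, ContKernel.kernel k x = ContKernel.kernel l x) :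
    k = l := ext_apply h

lemma id_eq (X : TopStoch.{u}) : 𝟙 X = diracHom id continuous_id := rfl

lemma diracHom_comp (f : X.carrier → Y.carrier) (hf : Continuous f)
    (g : Y.carrier → Z.carrier) (hg : Continuous g) :
    diracHom f hf ≫ diracHom g hg = diracHom (g ∘ f) (hg.comp hf) := dirac_comp_dirac _ _ _ _

lemma whiskerLeft_diracHom (W : TopStoch.{u}) (f : X.carrier → Y.carrier) (hf : Continuous f) :
    W ◁ diracHom f hf = diracHom (X := W ⊗ X) (Y := W ⊗ Y) (Prod.map id f)
      (continuous_id.prodMap hf) := whiskerLeft_dirac _ _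

lemma whiskerRight_diracHom (W : TopStoch.{u}) (f : X.carrier → Y.carrier) (hf : Continuous f) :
    diracHom f hf ▷ W = diracHom (X := X ⊗ W) (Y := Y ⊗ W) (Prod.map f id)
      (hf.prodMap continuous_id) := whiskerRight_dirac _ _

lemma wl_comp (W : TopStoch.{u}) (k : X ⟶ Y) (l : Y ⟶ Z) : W ◁ (k ≫ l) = W ◁ k ≫ W ◁ l :=
  ContKernel.whiskerLeft_comp _ _

lemma wr_comp (W : TopStoch.{u}) (k : X ⟶ Y) (l : Y ⟶ Z) : (k ≫ l) ▷ W = k ▷ W ≫ l ▷ W :=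
  ContKernel.whiskerRight_comp _ _

lemma w_exchange (k : X ⟶ Y) (l : W ⟶ Z) : X ◁ l ≫ k ▷ Z = k ▷ W ≫ Y ◁ l :=
  ContKernel.whisker_exchange _ _

lemma tensorHom_eq (k : X ⟶ Y) (l : W ⟶ Z) : k ⊗ₘ l = k ▷ W ≫ Y ◁ l := rfl

lemma comp_diracHom_apply (k : X ⟶ Y) (f : Y.carrier → Z.carrier) (hf : Continuous f)
    (x : X.carrier) :
    ContKernel.kernel (k ≫ diracHom f hf) x
      = @Measure.map _ _ (borel _) (borel _) f (ContKernel.kernel k x) :=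
  dirac_comp _ _ _ _

lemma diracHom_comp_apply (k : Y ⟶ Z) (f : X.carrier → Y.carrier) (hf : Continuous f)
    (x : X.carrier) :
    ContKernel.kernel (diracHom f hf ≫ k) x = ContKernel.kernel k (f x) :=
  comp_dirac _ _ _ _

lemma whiskerLeft_hom_apply (W : TopStoch.{u}) (k : X ⟶ Y) (p : W.carrier × X.carrier) :
    ContKernel.kernel (W ◁ k) p
      = @Measure.map _ _ (borel _) (borel _) (fun y => (p.1, y)) (ContKernel.kernel k p.2) := rfl

lemma whiskerRight_hom_apply (W : TopStoch.{u}) (k : X ⟶ Y) (p : X.carrier × W.carrier) :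
    ContKernel.kernel (k ▷ W) p
      = @Measure.map _ _ (borel _) (borel _) (fun y => (y, p.2)) (ContKernel.kernel k p.1) := rfl

/-- `k ⊗ l` is the product kernel. -/
lemma tensorHom_prod_apply (k : X ⟶ Y) (l : W ⟶ Z) (p : X.carrier × W.carrier)
    {A : Set Y.carrier} {B : Set Z.carrier} (hA : MeasurableSet[borel _] A)
    (hB : MeasurableSet[borel _] B) :
    ContKernel.kernel (k ⊗ₘ l) p (A ×ˢ B)
      = ContKernel.kernel k p.1 A * ContKernel.kernel l p.2 B :=
  whisker_rect k l p hA <| by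
    have h1 := @borelMeasurable (Y.carrier × Z.carrier) _ _ _ _ continuous_fst
    have h2 := @borelMeasurable (Y.carrier × Z.carrier) _ _ _ _ continuous_snd
    exact @MeasurableSet.inter _ (borel _) _ _ (h1 hA) (h2 hB)

lemma map_map_borel {X Y Z : Type*} [TopologicalSpace X] [TopologicalSpace Y] [TopologicalSpace Z]
    (μ : @Measure X (borel X)) {f : X → Y} {g : Y → Z} (hf : Continuous f) (hg : Continuous g) :
    @Measure.map _ _ (borel _) (borel _) g (@Measure.map _ _ (borel _) (borel _) f μ)
      = @Measure.map _ _ (borel _) (borel _) (g ∘ f) μ :=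
  @Measure.map_map _ _ _ (borel _) (borel _) (borel _) _ _ _ (borelMeasurable hg)
    (borelMeasurable hf)

lemma natural_of_map (k : X ⟶ Y) (f : Y.carrier ≃ₜ Z.carrier) (g : X.carrier ≃ₜ W.carrier)
    (l : W ⟶ Z)
    (h : ∀ x, @Measure.map _ _ (borel _) (borel _) f (ContKernel.kernel k x)
      = ContKernel.kernel l (g x)) :
    k ≫ (diracIso f).hom = (diracIso g).hom ≫ l :=
  hom_ext_apply fun x => (comp_diracHom_apply k f f.continuous x).trans
    ((h x).trans (diracHom_comp_apply l g g.continuous x).symm)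

lemma associator_hom_eq (X Y Z : TopStoch.{u}) : (α_ X Y Z).hom
    = diracHom (X := (X ⊗ Y) ⊗ Z) (Y := X ⊗ (Y ⊗ Z))
      (Homeomorph.prodAssoc X.carrier Y.carrier Z.carrier) (Homeomorph.continuous _) := rfl

lemma associator_inv_eq (X Y Z : TopStoch.{u}) : (α_ X Y Z).inv
    = diracHom (X := X ⊗ (Y ⊗ Z)) (Y := (X ⊗ Y) ⊗ Z)
      (Homeomorph.prodAssoc X.carrier Y.carrier Z.carrier).symm (Homeomorph.continuous _) := rfl

lemma leftUnitor_hom_eq (X : TopStoch.{u}) : (λ_ X).hom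
    = diracHom (X := 𝟙_ TopStoch ⊗ X) (Homeomorph.punitProd X.carrier)
      (Homeomorph.continuous _) := rfl

lemma leftUnitor_inv_eq (X : TopStoch.{u}) : (λ_ X).inv
    = diracHom (Y := 𝟙_ TopStoch ⊗ X) (Homeomorph.punitProd X.carrier).symm
      (Homeomorph.continuous _) := rfl

lemma rightUnitor_hom_eq (X : TopStoch.{u}) : (ρ_ X).hom
    = diracHom (X := X ⊗ 𝟙_ TopStoch) (Homeomorph.prodPUnit X.carrier)
      (Homeomorph.continuous _) := rfl

lemma rightUnitor_inv_eq (X : TopStoch.{u}) : (ρ_ X).inv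
    = diracHom (Y := X ⊗ 𝟙_ TopStoch) (Homeomorph.prodPUnit X.carrier).symm
      (Homeomorph.continuous _) := rfl

lemma associator_nat_left (f : X ⟶ Y) (Z W : TopStoch.{u}) :
    (f ▷ Z) ▷ W ≫ (α_ Y Z W).hom = (α_ X Z W).hom ≫ f ▷ (Z ⊗ W) :=
  natural_of_map _ _ _ _ fun _ =>
    (map_map_borel _ (Continuous.prodMk_left _) (Homeomorph.continuous _)).trans
      (map_map_borel _ (Continuous.prodMk_left _)
        ((Homeomorph.continuous _).comp (Continuous.prodMk_left _)))

lemma associator_nat_middle (f : X ⟶ Y) (Z W : TopStoch.{u}) :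
    (Z ◁ f) ▷ W ≫ (α_ Z Y W).hom = (α_ Z X W).hom ≫ Z ◁ (f ▷ W) :=
  natural_of_map _ _ _ _ fun _ =>
    (map_map_borel _ (Continuous.prodMk_left _) (Homeomorph.continuous _)).trans
      ((map_map_borel _ (Continuous.prodMk_right _)
        ((Homeomorph.continuous _).comp (Continuous.prodMk_left _))).trans
      (map_map_borel _ (Continuous.prodMk_left _) (Continuous.prodMk_right _)).symm)

lemma associator_nat_right (f : X ⟶ Y) (Z W : TopStoch.{u}) :
    (Z ⊗ W) ◁ f ≫ (α_ Z W Y).hom = (α_ Z W X).hom ≫ Z ◁ (W ◁ f) :=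
  natural_of_map _ _ _ _ fun p =>
    (map_map_borel _ (Continuous.prodMk_right _) (Homeomorph.continuous _)).trans
      (map_map_borel (ContKernel.kernel f p.2) (Continuous.prodMk_right p.1.2)
        (Continuous.prodMk_right p.1.1)).symm

end aux

instance : MonoidalCategory TopStoch.{u} where
  tensorHom_def _ _ := rfl
  id_tensorHom_id X Y := by
    rw [tensorHom_eq, id_eq, id_eq, whiskerLeft_diracHom, whiskerRight_diracHom, diracHom_comp]
    rfl
  tensorHom_comp_tensorHom f₁ f₂ g₁ g₂ := by
    simp only [tensorHom_eq, wl_comp, wr_comp, Category.assoc]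
    rw [← Category.assoc (_ ◁ f₂), w_exchange, Category.assoc]
  whiskerLeft_id X Y := by
    rw [id_eq, whiskerLeft_diracHom]; rfl
  id_whiskerRight X Y := by
    rw [id_eq, whiskerRight_diracHom]; rfl
  associator_naturality {X₁ X₂ X₃ Y₁ Y₂ Y₃} f₁ f₂ f₃ := by
    simp only [tensorHom_eq, wl_comp, wr_comp, Category.assoc]
    rw [associator_nat_right, ← Category.assoc (_ ▷ _) (α_ Y₁ Y₂ X₃).hom, associator_nat_middle,
      Category.assoc, ← Category.assoc (_ ▷ _) (α_ Y₁ X₂ X₃).hom, associator_nat_left,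
      Category.assoc]
  leftUnitor_naturality f := natural_of_map _ _ _ _ fun _ =>
    (map_map_borel _ (Continuous.prodMk_right _) (Homeomorph.continuous _)).trans
      (@Measure.map_id _ (borel _) _)
  rightUnitor_naturality f := natural_of_map _ _ _ _ fun _ =>
    (map_map_borel _ (Continuous.prodMk_left _) (Homeomorph.continuous _)).trans
      (@Measure.map_id _ (borel _) _)
  pentagon W X Y Z := by
    simp only [associator_hom_eq, whiskerLeft_diracHom, whiskerRight_diracHom, diracHom_comp]
    rfl
  triangle X Y := by
    simp only [associator_hom_eq, leftUnitor_hom_eq, rightUnitor_hom_eq, whiskerLeft_diracHom,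
      whiskerRight_diracHom, diracHom_comp]
    rfl

/-- The swap `(x, y) ↦ δ_{(y, x)}`. -/
def swapIso (X Y : TopStoch.{u}) : X ⊗ Y ≅ Y ⊗ X :=
  diracIso (X := X ⊗ Y) (Y := Y ⊗ X) (Homeomorph.prodComm X.carrier Y.carrier)

lemma swapIso_hom_eq (X Y : TopStoch.{u}) : (swapIso X Y).hom
    = diracHom (X := X ⊗ Y) (Y := Y ⊗ X) Prod.swap continuous_swap := rfl

instance : SymmetricCategory TopStoch.{u} where
  braiding := swapIso
  braiding_naturality_right X Y Z f := natural_of_map _ _ _ _ fun _ =>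
    map_map_borel _ (Continuous.prodMk_right _) (Homeomorph.continuous _)
  braiding_naturality_left f Z := natural_of_map _ _ _ _ fun _ =>
    map_map_borel _ (Continuous.prodMk_left _) (Homeomorph.continuous _)
  hexagon_forward X Y Z := by
    simp only [associator_hom_eq, swapIso_hom_eq, whiskerLeft_diracHom, whiskerRight_diracHom,
      diracHom_comp]
    rfl
  hexagon_reverse X Y Z := by
    simp only [associator_inv_eq, swapIso_hom_eq, whiskerLeft_diracHom, whiskerRight_diracHom,
      diracHom_comp]
    rfl
  symmetry X Y := by
    simp only [swapIso_hom_eq, diracHom_comp]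
    rfl

lemma braiding_hom_eq (X Y : TopStoch.{u}) : (β_ X Y).hom
    = diracHom (X := X ⊗ Y) (Y := Y ⊗ X) Prod.swap continuous_swap := rfl

/-- Copying: `x ↦ δ_{(x, x)}`. -/
def copy (X : TopStoch.{u}) : X ⟶ X ⊗ X :=
  diracHom (Y := X ⊗ X) (fun x => (x, x)) (continuous_id.prodMk continuous_id)

/-- Discarding: the only kernel to the one-point space. -/
def discard (X : TopStoch.{u}) : X ⟶ 𝟙_ TopStoch.{u} :=
  diracHom (Y := 𝟙_ TopStoch) (fun _ => PUnit.unit) continuous_const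

instance (X : TopStoch.{u}) : ComonObj X where
  counit := discard X
  comul := copy X
  counit_comul := by
    simp only [copy, discard, leftUnitor_inv_eq, whiskerRight_diracHom, diracHom_comp]
    rfl
  comul_counit := by
    simp only [copy, discard, rightUnitor_inv_eq, whiskerLeft_diracHom, diracHom_comp]
    rfl
  comul_assoc := by
    simp only [copy, associator_hom_eq, whiskerLeft_diracHom, whiskerRight_diracHom, diracHom_comp]
    rfl

lemma comul_eq (X : TopStoch.{u}) : Δ[X] = diracHom (Y := X ⊗ X) (fun x => (x, x))
    (continuous_id.prodMk continuous_id) := rfl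

lemma counit_eq (X : TopStoch.{u}) : ε[X] = diracHom (Y := 𝟙_ TopStoch) (fun _ => PUnit.unit)
    continuous_const := rfl

instance : MarkovCategory TopStoch.{u} where
  isCommComonObj X := ⟨by
    simp only [comul_eq, braiding_hom_eq, diracHom_comp]
    rfl⟩
  copy_tensor X Y := by
    simp only [comul_eq, MonoidalCategory.tensorμ, braiding_hom_eq, associator_hom_eq,
      associator_inv_eq, MonoidalCategory.tensorHom_def, whiskerLeft_diracHom,
      whiskerRight_diracHom, diracHom_comp]
    rfl
  discard_tensor X Y := by
    simp only [counit_eq, leftUnitor_hom_eq, MonoidalCategory.tensorHom_def, whiskerLeft_diracHom,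
      whiskerRight_diracHom, diracHom_comp]
    rfl
  copy_unit := rfl
  discard_unit := rfl
  discard_natural {X Y} f := by
    refine hom_ext_apply fun x => ?_
    have hp : IsProbabilityMeasure (ContKernel.kernel f x) := (ContKernel.isMarkov f).1 x
    refine (comp_diracHom_apply f _ continuous_const x).trans ?_
    refine (@Measure.map_const _ _ (borel _) (borel _) _ _).trans ?_
    rw [measure_univ, one_smul]
    rfl

/-! ### The invariant topology and the orbit map -/

/-- An open set `U` is invariant under `act` if `act(U|g, x) = 1` for all `g` and all `x ∈ U`. -/
def IsInvariantOpen {G X : TopStoch.{u}} (act : G ⊗ X ⟶ X) (U : Set X.carrier) : Prop :=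
  IsOpen U ∧ ∀ (g : G.carrier), ∀ x ∈ U, ContKernel.kernel act (g, x) U = 1

/-- The topology on `X` whose open sets are the invariant open sets. -/
@[reducible] def invariantTopology {G X : TopStoch.{u}} (act : G ⊗ X ⟶ X) : TopologicalSpace X.carrier where
  IsOpen := IsInvariantOpen act
  isOpen_univ := ⟨isOpen_univ, fun g x _ => by
    have : IsProbabilityMeasure (ContKernel.kernel act (g, x)) := (ContKernel.isMarkov act).1 _
    exact measure_univ⟩
  isOpen_inter U V hU hV := ⟨hU.1.inter hV.1, fun g x hx => by
    have : IsProbabilityMeasure (ContKernel.kernel act (g, x)) := (ContKernel.isMarkov act).1 _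
    have hU' := IsOpen.borelMeasurableSet hU.1
    have hV' := IsOpen.borelMeasurableSet hV.1
    have h1 := (mem_ae_iff_prob_eq_one hU').mpr (hU.2 g x hx.1)
    have h2 := (mem_ae_iff_prob_eq_one hV').mpr (hV.2 g x hx.2)
    exact (mem_ae_iff_prob_eq_one (hU'.inter hV')).mp (Filter.inter_mem h1 h2)⟩
  isOpen_sUnion D hD := ⟨isOpen_sUnion fun U hU => (hD U hU).1, fun g x hx => by
    have : IsProbabilityMeasure (ContKernel.kernel act (g, x)) := (ContKernel.isMarkov act).1 _
    obtain ⟨U, hU, hxU⟩ := hx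
    refine le_antisymm prob_le_one ?_
    rw [← (hD U hU).2 g x hxU]
    exact measure_mono (Set.subset_sUnion_of_mem hU)⟩

/-- `X/G`: the points of `X` with the invariant topology. -/
def quotient {G X : TopStoch.{u}} (act : G ⊗ X ⟶ X) : TopStoch.{u} :=
  @of X.carrier (invariantTopology act)

/-- The kernel `q : X ⟶ X/G`, `q(A|x) = δ_x(A)`. -/
def quotientMap {G X : TopStoch.{u}} (act : G ⊗ X ⟶ X) : X ⟶ quotient act :=
  diracHom (Y := quotient act) (fun x => x) ⟨fun _ hU => And.left hU⟩

end

end TopStoch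

/-!
The action axioms make `act(g⁻¹, -)` undo `act(g, -)`. Hence a point almost surely neither leaves
nor enters an invariant open set, so `q` coequalises `act` and the trivial action. Dually, the
points which some `g` moves into an open set `U` with positive probability form the smallest
invariant open set containing `U`: `q` behaves like an open map.

A kernel on `X ⊗ Y` coequalising the two actions takes, on an open set, a lower semicontinuous value
`f(x, y)` that is harmonic in `x`; since `act` is `{0, 1}`-valued, the sets `{x | t < f(x, y)}` are
invariant. If a rectangle `A × B` lies in `{t < f}`, then so does its saturation in the first
factor, and therefore `f` is lower semicontinuous on `X/G × Y`.
-/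

section MarkovCategory

open MonoidalCategory

variable {C : Type u} [Category.{v} C]

lemma IsCoequaliser.of_epi {A B Q : C} {f g : A ⟶ B} {q : B ⟶ Q} [Epi q] (w : f ≫ q = g ≫ q)
    (h : ∀ {T : C} (k : B ⟶ T), f ≫ k = g ≫ k → ∃ l : Q ⟶ T, q ≫ l = k) :
    IsCoequaliser f g q :=
  ⟨w, ⟨Limits.Cofork.IsColimit.mk _ (fun s => (h s.π s.condition).choose)
    (fun s => (h s.π s.condition).choose_spec)
    fun s _ hm => (cancel_epi q).mp (hm.trans (h s.π s.condition).choose_spec.symm)⟩⟩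

variable [MonoidalCategory C]

lemma IsCoequaliser.of_whiskerRight_tensorUnit {A B Q : C} {f g : A ⟶ B} {q : B ⟶ Q}
    (h : IsCoequaliser (f ▷ 𝟙_ C) (g ▷ 𝟙_ C) (q ▷ 𝟙_ C)) : IsCoequaliser f g q := by
  obtain ⟨w, ⟨hq⟩⟩ := h
  have w' : f ≫ q = g ≫ q := by
    rwa [← comp_whiskerRight, ← comp_whiskerRight, whiskerRight_iff] at w
  exact ⟨w', ⟨Limits.Cofork.isColimitOfIsos _ hq _ (ρ_ A) (ρ_ B) (ρ_ Q)⟩⟩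

lemma IsMarkovAction.inv_act [MarkovCategory C] {G X : C} [MarkovGroup G] {act : G ⊗ X ⟶ X}
    (hact : IsMarkovAction act) :
    Δ[G] ▷ X ≫ (α_ G G X).hom ≫ G ◁ act ≫ MarkovGroup.inv ▷ X ≫ act = trivialAction G X :=
  calc Δ[G] ▷ X ≫ (α_ G G X).hom ≫ G ◁ act ≫ MarkovGroup.inv ▷ X ≫ act
    _ = (Δ[G] ≫ MarkovGroup.inv ▷ G) ▷ X ≫ (α_ G G X).hom ≫ G ◁ act ≫ act := by
      rw [whisker_exchange_assoc, comp_whiskerRight, Category.assoc,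
        associator_naturality_left_assoc]
    _ = (Δ[G] ≫ MarkovGroup.inv ▷ G ≫ MarkovGroup.mul) ▷ X ≫ act := by
      rw [hact.assoc, Iso.hom_inv_id_assoc, ← comp_whiskerRight_assoc, Category.assoc]
    _ = trivialAction G X := by
      rw [MarkovGroup.inv_mul, comp_whiskerRight_assoc, hact.unit, trivialAction]

end MarkovCategory

namespace TopStoch

section Borel

open ContKernel (kernel)

attribute [local instance 2000] borel

variable {G X Y Z W : TopStoch.{u}}

instance isProbabilityMeasure_kernel (k : X ⟶ Y) (x : X.carrier) :
    IsProbabilityMeasure (kernel k x) :=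
  (ContKernel.isMarkov k).1 x

lemma measurable_kernel (k : X ⟶ Y) {A : Set Y.carrier} (hA : MeasurableSet A) :
    Measurable fun x => kernel k x A :=
  ContKernel.kernel_measurable_coe k hA

lemma isOpen_setOf_kernel_ne_zero (k : X ⟶ Y) {U : Set Y.carrier} (hU : IsOpen U) :
    IsOpen {x | kernel k x U ≠ 0} := by
  simp_rw [← pos_iff_ne_zero]
  exact (ContKernel.lsc k U hU).isOpen_preimage 0

lemma kernel_comp_apply (k : X ⟶ Y) (l : Y ⟶ Z) (x : X.carrier) {A : Set Z.carrier}
    (hA : MeasurableSet A) : kernel (k ≫ l) x A = ∫⁻ y, kernel l y A ∂kernel k x :=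
  ContKernel.comp_apply_open l k x hA

lemma kernel_whiskerRight_comp_apply (k : X ⟶ Y) (l : Y ⊗ W ⟶ Z) (x : X.carrier) (w : W.carrier)
    {A : Set Z.carrier} (hA : MeasurableSet A) :
    kernel (k ▷ W ≫ l) (x, w) A = ∫⁻ y, kernel l (y, w) A ∂kernel k x :=
  (kernel_comp_apply (k ▷ W) l (x, w) hA).trans <|
    lintegral_map (measurable_kernel l hA) (borelMeasurable (Continuous.prodMk_left w))

lemma kernel_whiskerLeft_comp_apply (k : X ⟶ Y) (l : W ⊗ Y ⟶ Z) (w : W.carrier) (x : X.carrier)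
    {A : Set Z.carrier} (hA : MeasurableSet A) :
    kernel (W ◁ k ≫ l) (w, x) A = ∫⁻ y, kernel l (w, y) A ∂kernel k x :=
  (kernel_comp_apply (W ◁ k) l (w, x) hA).trans <|
    lintegral_map (measurable_kernel l hA) (borelMeasurable (Continuous.prodMk_right w))

lemma deterministic_diracHom (f : X.carrier → Y.carrier) (hf : Continuous f) :
    Deterministic (diracHom f hf) where
  hom_counit := MarkovCategory.discard_natural _
  hom_comul := by
    simp only [comul_eq, MonoidalCategory.tensorHom_def, whiskerLeft_diracHom,
      whiskerRight_diracHom, diracHom_comp]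
    rfl

lemma kernel_inter_of_deterministic {k : X ⟶ Y} (hk : Deterministic k) (x : X.carrier)
    {A B : Set Y.carrier} (hA : MeasurableSet A) (hB : MeasurableSet B) :
    kernel k x (A ∩ B) = kernel k x A * kernel k x B := by
  have hAB : MeasurableSet (A ×ˢ B) :=
    (borelMeasurable continuous_fst hA).inter (borelMeasurable continuous_snd hB)
  have hdiag : Measurable fun y : Y.carrier => (y, y) :=
    borelMeasurable (continuous_id.prodMk continuous_id)
  calc kernel k x (A ∩ B) = kernel (k ≫ Δ[Y]) x (A ×ˢ B) := by
        rw [comul_eq, comp_diracHom_apply]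
        exact (Measure.map_apply hdiag hAB).symm
    _ = kernel (Δ[X] ≫ (k ⊗ₘ k)) x (A ×ˢ B) := by rw [Deterministic.copy_natural]
    _ = kernel k x A * kernel k x B := by
        rw [comul_eq, diracHom_comp_apply]
        exact tensorHom_prod_apply k k (x, x) hA hB

lemma kernel_eq_one_of_deterministic {k : X ⟶ Y} (hk : Deterministic k) {x : X.carrier}
    {A : Set Y.carrier} (hA : MeasurableSet A) (h : kernel k x A ≠ 0) : kernel k x A = 1 := by
  have hsq := kernel_inter_of_deterministic hk x hA hA
  rw [Set.inter_self] at hsq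
  exact (ENNReal.mul_eq_left h (measure_ne_top _ _)).mp hsq.symm

lemma trivialAction_eq (G X : TopStoch.{u}) :
    trivialAction G X = diracHom (X := G ⊗ X) Prod.snd continuous_snd := by
  simp only [trivialAction, counit_eq, leftUnitor_hom_eq, whiskerRight_diracHom, diracHom_comp]
  rfl

/-- The saturation of `A`: the points which some `g` moves into `A` with positive probability.
When `act` is an action and `A` is open, it is the smallest invariant open set containing `A`. -/
def saturation (act : G ⊗ X ⟶ X) (A : Set X.carrier) : Set X.carrier :=
  {x | ∃ g : G.carrier, kernel act (g, x) A ≠ 0}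

lemma isOpen_saturation (act : G ⊗ X ⟶ X) {U : Set X.carrier} (hU : IsOpen U) :
    IsOpen (saturation act U) := by
  simp only [saturation, Set.ofPred_exists]
  exact isOpen_iUnion fun g =>
    (isOpen_setOf_kernel_ne_zero act hU).preimage (Continuous.prodMk_right g)

lemma isInvariantOpen_setOf_lt {act : G ⊗ X ⟶ X} (hdet : Deterministic act)
    {f : X.carrier → ℝ≥0∞} (hf : LowerSemicontinuous f)
    (hharm : ∀ (g : G.carrier) (x : X.carrier), ∫⁻ y, f y ∂kernel act (g, x) = f x)
    (t : ℝ≥0∞) : IsInvariantOpen act {x | t < f x} := by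
  have hopen : IsOpen {x | t < f x} := hf.isOpen_preimage t
  refine ⟨hopen, fun g x hx => ?_⟩
  refine kernel_eq_one_of_deterministic hdet hopen.borelMeasurableSet fun hzero => ?_
  have hle : ∀ᵐ y ∂kernel act (g, x), f y ≤ t :=
    (measure_eq_zero_iff_ae_notMem.mp hzero).mono fun y hy => not_lt.mp hy
  refine (show t < f x from hx).not_ge ?_
  calc f x = ∫⁻ y, f y ∂kernel act (g, x) := (hharm g x).symm
    _ ≤ ∫⁻ _, t ∂kernel act (g, x) := lintegral_mono_ae hle
    _ = t := by rw [lintegral_const, measure_univ, mul_one]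

/-- The identity of `X` as a map `X → X/G`; a separate name keeps the topologies of its source and
target apart. -/
def toQuotient (act : G ⊗ X ⟶ X) : X.carrier → (quotient act).carrier := fun x => x

lemma continuous_toQuotient (act : G ⊗ X ⟶ X) : Continuous (toQuotient act) :=
  ⟨fun _ hU => And.left hU⟩

lemma quotientMap_eq (act : G ⊗ X ⟶ X) :
    quotientMap act = diracHom (toQuotient act) (continuous_toQuotient act) := rfl

section Action

variable [MarkovGroup G] {act : G ⊗ X ⟶ X}

lemma lintegral_act_act (hact : IsMarkovAction act) (h g : G.carrier) (x : X.carrier)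
    {A : Set X.carrier} (hA : MeasurableSet A) :
    ∫⁻ y, kernel act (h, y) A ∂kernel act (g, x)
      = ∫⁻ m, kernel act (m, x) A ∂kernel (MarkovGroup.mul (G := G)) (h, g) :=
  calc ∫⁻ y, kernel act (h, y) A ∂kernel act (g, x)
    _ = kernel (G ◁ act ≫ act) (h, g, x) A :=
      (kernel_whiskerLeft_comp_apply act act h (g, x) hA).symm
    _ = kernel (MarkovGroup.mul ▷ X ≫ act) ((h, g), x) A := by
      rw [hact.assoc, associator_inv_eq, diracHom_comp_apply]
      rfl
    _ = ∫⁻ m, kernel act (m, x) A ∂kernel (MarkovGroup.mul (G := G)) (h, g) :=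
      kernel_whiskerRight_comp_apply MarkovGroup.mul act (h, g) x hA

lemma lintegral_act_one (hact : IsMarkovAction act) (x : X.carrier) {A : Set X.carrier}
    (hA : MeasurableSet A) :
    ∫⁻ m, kernel act (m, x) A ∂kernel (MarkovGroup.one (G := G)) PUnit.unit
      = A.indicator 1 x :=
  calc ∫⁻ m, kernel act (m, x) A ∂kernel (MarkovGroup.one (G := G)) PUnit.unit
    _ = kernel (MarkovGroup.one ▷ X ≫ act) (PUnit.unit, x) A :=
      (kernel_whiskerRight_comp_apply MarkovGroup.one act PUnit.unit x hA).symm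
    _ = kernel (λ_ X).hom (PUnit.unit, x) A := by rw [hact.unit]
    _ = A.indicator 1 x := Measure.dirac_apply' x hA

lemma lintegral_act_inv_act (hact : IsMarkovAction act) (g : G.carrier) (x : X.carrier)
    {A : Set X.carrier} (hA : MeasurableSet A) :
    ∫⁻ y, ∫⁻ h, kernel act (h, y) A ∂kernel (MarkovGroup.inv (G := G)) g ∂kernel act (g, x)
      = A.indicator 1 x :=
  calc ∫⁻ y, ∫⁻ h, kernel act (h, y) A ∂kernel (MarkovGroup.inv (G := G)) g ∂kernel act (g, x)
    _ = ∫⁻ y, kernel (MarkovGroup.inv ▷ X ≫ act) (g, y) A ∂kernel act (g, x) :=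
      lintegral_congr fun y => (kernel_whiskerRight_comp_apply MarkovGroup.inv act g y hA).symm
    _ = kernel (G ◁ act ≫ MarkovGroup.inv ▷ X ≫ act) (g, g, x) A :=
      (kernel_whiskerLeft_comp_apply act _ g (g, x) hA).symm
    _ = kernel (Δ[G] ▷ X ≫ (α_ G G X).hom ≫ G ◁ act ≫ MarkovGroup.inv ▷ X ≫ act) (g, x) A := by
      rw [comul_eq, whiskerRight_diracHom, diracHom_comp_apply, associator_hom_eq,
        diracHom_comp_apply]
      rfl
    _ = kernel (trivialAction G X) (g, x) A := by rw [hact.inv_act]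
    _ = A.indicator 1 x := by
      rw [trivialAction_eq]
      exact Measure.dirac_apply' x hA

lemma subset_saturation (hact : IsMarkovAction act) {A : Set X.carrier} (hA : MeasurableSet A) :
    A ⊆ saturation act A := by
  intro x hx
  by_contra hsat
  have hzero : ∀ g : G.carrier, kernel act (g, x) A = 0 := by simpa [saturation] using hsat
  simpa [hzero, hx] using lintegral_act_one hact x hA

lemma saturation_setOf_kernel_ne_zero_subset (hact : IsMarkovAction act) (g : G.carrier)
    {A : Set X.carrier} (hA : MeasurableSet A) :
    saturation act {z | kernel act (g, z) A ≠ 0} ⊆ saturation act A := by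
  rintro y ⟨h, hh⟩
  by_contra hsat
  have hzero : ∀ m : G.carrier, kernel act (m, y) A = 0 := by simpa [saturation] using hsat
  have hint : ∫⁻ z, kernel act (g, z) A ∂kernel act (h, y) = 0 := by
    simp only [lintegral_act_act hact g h y hA, hzero, lintegral_zero]
  have hmeas : Measurable fun z => kernel act (g, z) A :=
    (measurable_kernel act hA).comp (borelMeasurable (Continuous.prodMk_right g))
  exact hh ((lintegral_eq_zero_iff hmeas).mp hint)

lemma frequently_mem_saturation (hact : IsMarkovAction act) (g : G.carrier) {x : X.carrier}
    {A : Set X.carrier} (hA : MeasurableSet A) (hx : x ∈ A) :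
    ∃ᵐ y ∂kernel act (g, x), y ∈ saturation act A := by
  intro hsat
  have hzero : ∀ᵐ y ∂kernel act (g, x),
      ∫⁻ h, kernel act (h, y) A ∂kernel (MarkovGroup.inv (G := G)) g = 0 := by
    filter_upwards [hsat] with y hy
    have : ∀ h : G.carrier, kernel act (h, y) A = 0 := by simpa [saturation] using hy
    simp only [this, lintegral_zero]
  simpa [lintegral_congr_ae hzero, hx] using lintegral_act_inv_act hact g x hA

lemma isInvariantOpen_saturation (hact : IsMarkovAction act) {U : Set X.carrier}
    (hU : IsOpen U) : IsInvariantOpen act (saturation act U) := by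
  have hopen := isOpen_saturation act hU
  refine ⟨hopen, fun h x ⟨g, hg⟩ => ?_⟩
  have hV : IsOpen {z | kernel act (g, z) U ≠ 0} :=
    (isOpen_setOf_kernel_ne_zero act hU).preimage (Continuous.prodMk_right g)
  have hfreq : ∃ᵐ y ∂kernel act (h, x), y ∈ saturation act U :=
    (frequently_mem_saturation hact h hV.borelMeasurableSet hg).mono fun _ hy =>
      saturation_setOf_kernel_ne_zero_subset hact g hU.borelMeasurableSet hy
  exact kernel_eq_one_of_deterministic hact.deterministic hopen.borelMeasurableSet
    (frequently_ae_mem_iff.mp hfreq)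

lemma IsInvariantOpen.mem_of_kernel_ne_zero (hact : IsMarkovAction act) {U : Set X.carrier}
    (hU : IsInvariantOpen act U) {g : G.carrier} {x : X.carrier}
    (h : kernel act (g, x) U ≠ 0) : x ∈ U := by
  have hmeas : MeasurableSet U := hU.1.borelMeasurableSet
  have hone := kernel_eq_one_of_deterministic hact.deterministic hmeas h
  by_contra hx
  obtain ⟨y, ⟨h', hh'⟩, hy⟩ := ((frequently_mem_saturation hact g hmeas.compl hx).and_eventually
    ((mem_ae_iff_prob_eq_one hmeas).mpr hone)).exists
  exact hh' ((prob_compl_eq_zero_iff hmeas).mpr (hU.2 h' y hy))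

lemma IsInvariantOpen.kernel_apply (hact : IsMarkovAction act) {U : Set X.carrier}
    (hU : IsInvariantOpen act U) (g : G.carrier) (x : X.carrier) :
    kernel act (g, x) U = U.indicator 1 x := by
  by_cases hx : x ∈ U
  · simpa [hx] using hU.2 g x hx
  · simpa [hx] using mt (hU.mem_of_kernel_ne_zero hact (g := g)) hx

lemma IsInvariantOpen.saturation_subset (hact : IsMarkovAction act) {A U : Set X.carrier}
    (hU : IsInvariantOpen act U) (hAU : A ⊆ U) : saturation act A ⊆ U := fun _ ⟨_, hg⟩ =>
  hU.mem_of_kernel_ne_zero hact fun hzero => hg (measure_mono_null hAU hzero)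

lemma act_comp_quotientMap (hact : IsMarkovAction act) :
    act ≫ quotientMap act = trivialAction G X ≫ quotientMap act := by
  refine ContKernel.ext_open fun ⟨g, x⟩ U hU => ?_
  calc kernel (act ≫ quotientMap act) (g, x) U
    _ = kernel act (g, x) U := by
      rw [quotientMap_eq, comp_diracHom_apply]
      exact Measure.map_apply (borelMeasurable (continuous_toQuotient act)) hU.borelMeasurableSet
    _ = U.indicator 1 (toQuotient act x) := IsInvariantOpen.kernel_apply hact hU g x
    _ = kernel (trivialAction G X ≫ quotientMap act) (g, x) U := by
      rw [trivialAction_eq, diracHom_comp_apply]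
      exact (Measure.dirac_apply' (toQuotient act x) hU.borelMeasurableSet).symm

lemma lowerSemicontinuous_quotient_prod (hact : IsMarkovAction act) {W : Type*}
    [TopologicalSpace W] {f : X.carrier × W → ℝ≥0∞} (hf : LowerSemicontinuous f)
    (hharm : ∀ (g : G.carrier) (x : X.carrier) (w : W),
      ∫⁻ y, f (y, w) ∂kernel act (g, x) = f (x, w)) :
    LowerSemicontinuous fun p : (quotient act).carrier × W => f p := by
  refine lowerSemicontinuous_iff_isOpen_preimage.mpr fun t => isOpen_prod_iff.mpr fun x w hxw => ?_
  obtain ⟨A, B, hA, hB, hxA, hwB, hAB⟩ := isOpen_prod_iff.mp (hf.isOpen_preimage t) x w hxw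
  refine ⟨saturation (X := X) act A, B, isInvariantOpen_saturation hact hA, hB,
    subset_saturation hact hA.borelMeasurableSet hxA, hwB, fun ⟨z, v⟩ ⟨hz, hv⟩ => ?_⟩
  have hinv : IsInvariantOpen act {y | t < f (y, v)} :=
    isInvariantOpen_setOf_lt hact.deterministic (hf.comp (Continuous.prodMk_left v))
      (fun g y => hharm g y v) t
  exact hinv.saturation_subset hact (fun y hy => hAB (Set.mk_mem_prod hy hv)) hz

end Action

lemma lintegral_kernel_of_whiskerRight_comp_eq {act : G ⊗ X ⟶ X} {k : X ⊗ Y ⟶ Z}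
    (hk : act ▷ Y ≫ k = trivialAction G X ▷ Y ≫ k) (g : G.carrier) (x : X.carrier)
    (y : Y.carrier) {A : Set Z.carrier} (hA : MeasurableSet A) :
    ∫⁻ z, kernel k (z, y) A ∂kernel act (g, x) = kernel k (x, y) A :=
  calc ∫⁻ z, kernel k (z, y) A ∂kernel act (g, x)
    _ = kernel (act ▷ Y ≫ k) ((g, x), y) A :=
      (kernel_whiskerRight_comp_apply act k (g, x) y hA).symm
    _ = kernel k (x, y) A := by
      rw [hk, trivialAction_eq, whiskerRight_diracHom, diracHom_comp_apply]
      rfl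

lemma kernel_quotientMap_whiskerRight_comp {act : G ⊗ X ⟶ X} (l : quotient act ⊗ Y ⟶ Z)
    (x : X.carrier) (y : Y.carrier) :
    kernel (quotientMap act ▷ Y ≫ l) (x, y) = kernel l (toQuotient act x, y) := by
  rw [quotientMap_eq, whiskerRight_diracHom, diracHom_comp_apply]
  rfl

instance epi_quotientMap_whiskerRight (act : G ⊗ X ⟶ X) (Y : TopStoch.{u}) :
    Epi (quotientMap act ▷ Y) where
  left_cancellation k l h := hom_ext_apply fun ⟨x, y⟩ =>
    calc kernel k (toQuotient act x, y)
      _ = kernel (quotientMap act ▷ Y ≫ k) (x, y) :=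
        (kernel_quotientMap_whiskerRight_comp k x y).symm
      _ = kernel (quotientMap act ▷ Y ≫ l) (x, y) := by rw [h]
      _ = kernel l (toQuotient act x, y) := kernel_quotientMap_whiskerRight_comp l x y

lemma exists_quotientMap_whiskerRight_comp_eq [MarkovGroup G] {act : G ⊗ X ⟶ X}
    (hact : IsMarkovAction act) {k : X ⊗ Y ⟶ Z}
    (hk : act ▷ Y ≫ k = trivialAction G X ▷ Y ≫ k) :
    ∃ l : quotient act ⊗ Y ⟶ Z, quotientMap act ▷ Y ≫ l = k := by
  let l : quotient act ⊗ Y ⟶ Z := ContKernel.ofFun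
    (fun p : (quotient act).carrier × Y.carrier => kernel k p)
    (fun p => isProbabilityMeasure_kernel k p) (fun p => ContKernel.tauSmooth k p)
    fun U hU => lowerSemicontinuous_quotient_prod hact (ContKernel.lsc k U hU) fun g x y =>
      lintegral_kernel_of_whiskerRight_comp_eq hk g x y hU.borelMeasurableSet
  exact ⟨l, hom_ext_apply fun ⟨x, y⟩ => kernel_quotientMap_whiskerRight_comp l x y⟩

lemma isCoequaliser_quotientMap_whiskerRight [MarkovGroup G] {act : G ⊗ X ⟶ X}
    (hact : IsMarkovAction act) (Y : TopStoch.{u}) :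
    IsCoequaliser (act ▷ Y) (trivialAction G X ▷ Y) (quotientMap act ▷ Y) :=
  .of_epi (by rw [← wr_comp, ← wr_comp, act_comp_quotientMap hact]) fun _ hk =>
    exists_quotientMap_whiskerRight_comp_eq hact hk

end Borel

end TopStoch

theorem mainTheorem2 {G X : TopStoch.{u}} [MarkovGroup G] (act : G ⊗ X ⟶ X)
    (hact : IsMarkovAction act) :
    (∃ (Q : TopStoch.{u}) (q : X ⟶ Q), IsOrbitMap act q) ∧
      IsOrbitMap act (TopStoch.quotientMap act) := by
  have hpreserved (Y : TopStoch.{u}) :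
      IsCoequaliser (act ▷ Y) (trivialAction G X ▷ Y) (TopStoch.quotientMap act ▷ Y) :=
    TopStoch.isCoequaliser_quotientMap_whiskerRight hact Y
  have horbit : IsOrbitMap act (TopStoch.quotientMap act) :=
    { deterministic := TopStoch.deterministic_diracHom _ _
      coequaliser := (hpreserved (𝟙_ TopStoch)).of_whiskerRight_tensorUnit
      preserved := hpreserved }
  exact ⟨⟨_, _, horbit⟩, horbit⟩
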